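/- Let $n \ge 2$ and let $S^{2n-1} = \{z \in \mathbb{C}^n : |z| = 1\}$. Let $A \subseteq S^{2n-1}$ be a non-empty real algebraic set given by one or two polynomial equations, that is, $A = \{z \in S^{2n-1} : q_1(z) = q_2(z) = 0\}$, where $q_1, q_2$ are real polynomials (possibly equal) in the $2n$ real coordinates $\operatorname{Re} z_j, \operatorname{Im} z_j$ of $\mathbb{C}^n$. Then for every $k \in \mathbb{N}$ there exists a $\mathcal{C}^k$ embedding $f : S^{2n-1} \hookrightarrow \mathbb{C}^{2n-1}$ whose set of complex tangents is exactly $A$. Here a $\mathcal{C}^k$ embedding is a map of class $\mathcal{C}^k$ that is differentiable with injective real differential at every point and is a homeomorphism onto its image; a point $x \in S^{2n-1}$ is a complex tangent of $f$ if the real tangent space $T = df_x(T_x S^{2n-1}) \subseteq \mathbb{C}^{2n-1}$ contains a complex line, i.e. if $T \cap iT \neq \{0\}$. -/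

import Mathlib

open scoped Manifold ContDiff

noncomputable section

namespace ComplexTangency

/-- Complex `m`-space with its Euclidean norm. -/
abbrev CSpace (m : ℕ) : Type := EuclideanSpace ℂ (Fin m)

/-- The unit sphere `S^{2n-1}` of `ℂ^n`. -/
abbrev OddSphere (n : ℕ) : Type := Metric.sphere (0 : CSpace n) 1

/-- `ℂ^n` has real dimension `(2n - 1) + 1`.  This makes Mathlib's smooth structure on the unit
sphere of a real inner product space available on `S^{2n-1}`. -/
instance fact_finrank_cSpace (n : ℕ) [NeZero n] :
    Fact (Module.finrank ℝ (CSpace n) = (2 * n - 1) + 1) := by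
  constructor
  have h : Module.finrank ℝ (CSpace n) = 2 * n := by
    rw [(WithLp.linearEquiv 2 ℝ (Fin n → ℂ)).finrank_eq, Module.finrank_pi_fintype]
    simp [Complex.finrank_real_complex, mul_comm]
  have hn : n ≠ 0 := NeZero.ne n
  omega

/-- The value at `z ∈ ℂ^n` of a real polynomial `q` in the `2n` real coordinates
`Re z_1, …, Re z_n` (the variables `Sum.inl j`) and `Im z_1, …, Im z_n` (the variables
`Sum.inr j`). -/
def realEval {n : ℕ} (q : MvPolynomial (Fin n ⊕ Fin n) ℝ) (z : CSpace n) : ℝ :=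
  MvPolynomial.eval (Sum.elim (fun j => (z j).re) (fun j => (z j).im)) q

/-- `A ⊆ S^{2n-1}` is a real algebraic set given by one or two polynomial equations.
(One equation is the case `q₁ = q₂`.) -/
def IsAlgebraicByTwo {n : ℕ} (A : Set (OddSphere n)) : Prop :=
  ∃ q₁ q₂ : MvPolynomial (Fin n ⊕ Fin n) ℝ,
    A = {x | realEval q₁ (x : CSpace n) = 0 ∧ realEval q₂ (x : CSpace n) = 0}

section Embedding

variable {E H M : Type*} [NormedAddCommGroup E] [NormedSpace ℝ E] [TopologicalSpace H]
  (I : ModelWithCorners ℝ E H) [TopologicalSpace M] [ChartedSpace H M] {m : ℕ}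

/-- A `C^k` embedding of a manifold into `ℂ^m`: a `C^k` map that is an immersion (its real
differential is injective at every point) and a homeomorphism onto its image. -/
structure IsCkEmbedding (k : ℕ) (f : M → CSpace m) : Prop where
  contMDiff : ContMDiff I 𝓘(ℝ, CSpace m) k f
  injective_mvfderiv : ∀ x : M, Function.Injective (mvfderiv I f x)
  isEmbedding : Topology.IsEmbedding f

/-- The set of complex tangents of `f : M → ℂ^m`: the points `x` at which the real tangent space
`T = df_x(T_x M)` contains a complex line, that is, `T ∩ iT ≠ 0`. -/
def complexTangents (f : M → CSpace m) : Set M :=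
  {x | ∃ v : CSpace m, v ≠ 0 ∧ v ∈ (mvfderiv I f x).range ∧
    Complex.I • v ∈ (mvfderiv I f x).range}

end Embedding

end ComplexTangency

end

open ComplexTangency

open scoped ComplexConjugate

namespace ComplexTangency

/-! The embedding is a graph `z ↦ (z, g z)` with `g : ℂ^n → ℂ^(n-1)`. Its complex tangents are the
points where the tangential Cauchy-Riemann operator of `g` has a nontrivial kernel
(`mem_complexTangents_graph`).

Take a pole `p ∈ A` and put `w = 1 - ⟪p, z⟫`, `u = 1/w`, `ζ_j = ⟪b_j, z⟫/w`. These are CR functions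
off `p`, and on the sphere `conj u = |ζ|² + 1 - u`. So `q₁ + i q₂`, times a power of `|u|²`, is a
polynomial `P` in `u`, `ζ`, `conj ζ`, the last treated as free variables. Let `G` have components
`conj ζ_j`, except one that is a primitive of `P` in its own `conj ζ_{i₀}`. The matrix of the CR
operator is then the identity with one row replaced, with determinant `P`, hence is degenerate
exactly on `A` off `p` (`exists_fderiv_cayleyMap_smul_I_iff`).

Finally `g = w^N G`. The CR factor `w^N` does not affect degeneracy off `p`; for large `N` it makes
`g` as smooth as required, with zero differential at `p`, so `p` is a complex tangent too. -/

/-- Off `0` this is the product rule. At `0` the function is `O(|w|^(m-b))` with `m - b ≥ 2`, so its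
derivative is zero, as is the formula. -/
lemma hasFDerivAt_pow_mul_conj_inv_pow {m b : ℕ} (h : b + 2 ≤ m) (w : ℂ) :
    HasFDerivAt (𝕜 := ℝ) (fun w : ℂ => w ^ m * (conj w)⁻¹ ^ b)
      (((m : ℂ) * (w ^ (m - 1) * (conj w)⁻¹ ^ b)) • (1 : ℂ →L[ℝ] ℂ)
        - ((b : ℂ) * (w ^ m * (conj w)⁻¹ ^ (b + 1))) • (Complex.conjCLE : ℂ →L[ℝ] ℂ)) w := by
  rcases eq_or_ne w 0 with rfl | hw
  · have h0 : (0 : ℂ) ^ (m - 1) = 0 := zero_pow (by omega)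
    have h1 : (0 : ℂ) ^ m = 0 := zero_pow (by omega)
    have hO : (fun w : ℂ => w ^ m * (conj w)⁻¹ ^ b) =O[nhds 0] fun w => ‖w - 0‖ ^ (m - b) := by
      refine Asymptotics.IsBigO.of_bound 1 (Filter.Eventually.of_forall fun y => ?_)
      rcases eq_or_ne y 0 with rfl | hy
      · simp [h1]
      · have : ‖y‖ ≠ 0 := norm_ne_zero_iff.2 hy
        simp only [norm_mul, norm_pow, norm_inv, RCLike.norm_conj, sub_zero, one_mul, norm_norm]
        rw [inv_pow, pow_sub₀ _ this (by omega : b ≤ m)]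
    convert! hO.hasFDerivAt (𝕜 := ℝ) (by omega) using 1
    ext v
    simp [h0, h1]
  · have hc : conj w ≠ 0 := by simpa using hw
    have h1 := (hasDerivAt_pow m w).complexToReal_fderiv
    have h2 := ((hasDerivAt_inv hc).pow b).complexToReal_fderiv
    have h3 := h2.comp w (Complex.conjCLE.hasFDerivAt (x := w))
    refine (h1.mul h3).congr_fderiv ?_
    ext v
    rcases b with _ | b
    · simp
    · simp
      field_simp
      ring

/-- Both coefficients of the derivative have the same shape with `m - b` lowered by one, so the
margin pays for `k` derivatives. -/
lemma contDiff_pow_mul_conj_inv_pow (k : ℕ) : ∀ {m b : ℕ}, b + k + 2 ≤ m →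
    ContDiff ℝ k (fun w : ℂ => w ^ m * (conj w)⁻¹ ^ b) := by
  induction k with
  | zero =>
    intro m b h
    rw [Nat.cast_zero, contDiff_zero, continuous_iff_continuousAt]
    exact fun w => (hasFDerivAt_pow_mul_conj_inv_pow h w).continuousAt
  | succ k ih =>
    intro m b h
    rw [Nat.cast_succ, contDiff_succ_iff_hasFDerivAt]
    refine ⟨_, ?_, hasFDerivAt_pow_mul_conj_inv_pow (by omega)⟩
    exact ((contDiff_const.mul (ih (by omega))).smul contDiff_const).sub
      ((contDiff_const.mul (ih (by omega))).smul contDiff_const)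

lemma surjective_pderiv {σ : Type*} (i : σ) :
    Function.Surjective (MvPolynomial.pderiv i : MvPolynomial σ ℂ → MvPolynomial σ ℂ) := by
  intro p
  induction p using MvPolynomial.induction_on' with
  | monomial s a =>
    refine ⟨MvPolynomial.monomial (s + Finsupp.single i 1) (a / (s i + 1)), ?_⟩
    have : (s i : ℂ) + 1 ≠ 0 := by exact_mod_cast Nat.succ_ne_zero (s i)
    rw [MvPolynomial.pderiv_monomial]
    simp [this]
  | add p q hp hq =>
    obtain ⟨P, rfl⟩ := hp
    obtain ⟨Q, rfl⟩ := hq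
    exact ⟨P + Q, map_add _ _ _⟩

lemma hasFDerivAt_mvPolynomial_eval {σ E : Type*} [Fintype σ] [NormedAddCommGroup E]
    [NormedSpace ℝ E] {φ : σ → E → ℂ} {φ' : σ → E →L[ℝ] ℂ} {z : E}
    (hφ : ∀ s, HasFDerivAt (φ s) (φ' s) z) (P : MvPolynomial σ ℂ) :
    HasFDerivAt (fun z => MvPolynomial.eval (fun s => φ s z) P)
      (∑ s, MvPolynomial.eval (fun s => φ s z) (MvPolynomial.pderiv s P) • φ' s) z := by
  induction P using MvPolynomial.induction_on with
  | C a =>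
    simp only [MvPolynomial.eval_C]
    refine (hasFDerivAt_const (𝕜 := ℝ) a z).congr_fderiv ?_
    ext v
    simp
  | add p q hp hq =>
    simp only [map_add]
    refine (hp.add hq).congr_fderiv ?_
    ext v
    simp [add_mul, Finset.sum_add_distrib]
  | mul_X p s hp =>
    classical
    simp only [map_mul, MvPolynomial.eval_X]
    refine (hp.mul (hφ s)).congr_fderiv ?_
    ext v
    simp [Derivation.leibniz, MvPolynomial.pderiv_X, add_mul, Finset.sum_add_distrib,
      Pi.single_apply, Finset.mul_sum, mul_assoc, apply_ite]

/-! ### Graphs over the sphere and their complex tangents -/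

lemma mvfderiv_comp_coe_sphere {n : ℕ} [NeZero n] {F : Type*} [NormedAddCommGroup F]
    [NormedSpace ℝ F] {f : CSpace n → F} (hf : Differentiable ℝ f) (x : OddSphere n) :
    (mvfderiv (𝓡 (2 * n - 1)) (fun y : OddSphere n => f y) x)
      = (fderiv ℝ f x).comp (mvfderiv (𝓡 (2 * n - 1)) ((↑) : OddSphere n → CSpace n) x) := by
  have h1 : MDifferentiableAt 𝓘(ℝ, CSpace n) 𝓘(ℝ, F) f (x : CSpace n) :=
    (hf x).mdifferentiableAt
  have h2 : MDifferentiableAt (𝓡 (2 * n - 1)) 𝓘(ℝ, CSpace n) ((↑) : OddSphere n → CSpace n) x :=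
    (contMDiff_coe_sphere (m := 1) x).mdifferentiableAt one_ne_zero
  have h3 := mfderiv_comp x h1 h2
  rw [mfderiv_eq_fderiv] at h3
  exact h3

lemma mem_range_mvfderiv_coe_sphere {n : ℕ} [NeZero n] (x : OddSphere n) (v : CSpace n) :
    v ∈ (mvfderiv (𝓡 (2 * n - 1)) ((↑) : OddSphere n → CSpace n) x).range
      ↔ (inner ℂ (x : CSpace n) v).re = 0 := by
  rw [range_mvfderiv_subtypeVal, Submodule.mem_orthogonal_singleton_iff_inner_right]
  simp [PiLp.inner_apply, Complex.inner]

section Graph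

variable {n : ℕ} {Y : Type*} [NormedAddCommGroup Y] [NormedSpace ℂ Y]
  (e : (CSpace n × Y) ≃L[ℂ] CSpace (2 * n - 1)) {g : CSpace n → Y}

lemma contDiff_graph {k : ℕ∞ω} (hg : ContDiff ℝ k g) :
    ContDiff ℝ k (fun z => e (z, g z)) :=
  ((e : (CSpace n × Y) →L[ℂ] CSpace (2 * n - 1)).restrictScalars ℝ).contDiff.comp
    (contDiff_id.prodMk hg)

lemma mvfderiv_graph_apply [NeZero n] (hg : Differentiable ℝ g) (x : OddSphere n)
    (v : TangentSpace (𝓡 (2 * n - 1)) x) :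
    mvfderiv (𝓡 (2 * n - 1)) (fun y : OddSphere n => e (y, g y)) x v
      = e (mvfderiv (𝓡 (2 * n - 1)) ((↑) : OddSphere n → CSpace n) x v,
        fderiv ℝ g x (mvfderiv (𝓡 (2 * n - 1)) ((↑) : OddSphere n → CSpace n) x v)) := by
  have h (z : CSpace n) : HasFDerivAt (fun z => e (z, g z))
      (((e : (CSpace n × Y) →L[ℂ] CSpace (2 * n - 1)).restrictScalars ℝ).comp
        ((ContinuousLinearMap.id ℝ _).prod (fderiv ℝ g z))) z :=
    (((e : (CSpace n × Y) →L[ℂ] CSpace (2 * n - 1)).restrictScalars ℝ).hasFDerivAt).comp z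
      ((hasFDerivAt_id z).prodMk (hg z).hasFDerivAt)
  rw [mvfderiv_comp_coe_sphere (f := fun z => e (z, g z))
    (fun z => (h z).differentiableAt), (h x).fderiv]
  rfl

/-- The graph of a `C^k` map, `k ≥ 1`, over the sphere is a `C^k` embedding. -/
lemma isCkEmbedding_graph [NeZero n] {k : ℕ} (hk : k ≠ 0) (hg : ContDiff ℝ k g) :
    IsCkEmbedding (𝓡 (2 * n - 1)) k (fun y : OddSphere n => e (y, g y)) where
  contMDiff := (contDiff_graph e hg).contMDiff.comp contMDiff_coe_sphere
  injective_mvfderiv x := by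
    intro v w h
    rw [mvfderiv_graph_apply e (hg.differentiable (by exact_mod_cast hk)),
      mvfderiv_graph_apply e (hg.differentiable (by exact_mod_cast hk))] at h
    exact injective_mvfderiv_subtypeVal_sphere x (Prod.ext_iff.1 (e.injective h)).1
  isEmbedding := by
    refine (Continuous.isClosedEmbedding ?_ ?_).isEmbedding
    · exact (contDiff_graph e hg).continuous.comp continuous_subtype_val
    · exact fun x y h => Subtype.ext (Prod.ext_iff.1 (e.injective h)).1

/-- A point of the graph over the sphere is a complex tangent iff the tangential Cauchy-Riemann
operator of the map has a nontrivial kernel there. -/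
lemma mem_complexTangents_graph [NeZero n] (hg : Differentiable ℝ g) (x : OddSphere n) :
    x ∈ complexTangents (𝓡 (2 * n - 1)) (fun y : OddSphere n => e (y, g y)) ↔
      ∃ v : CSpace n, v ≠ 0 ∧ inner ℂ (x : CSpace n) v = 0 ∧
        fderiv ℝ g x (Complex.I • v) = Complex.I • fderiv ℝ g x v := by
  constructor
  · rintro ⟨v, hv, ⟨a, rfl⟩, ⟨b, hb⟩⟩
    have ha := (mem_range_mvfderiv_coe_sphere x _).1 ⟨a, rfl⟩
    have hb' := (mem_range_mvfderiv_coe_sphere x _).1 ⟨b, rfl⟩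
    simp only [ContinuousLinearMap.coe_coe, mvfderiv_graph_apply e hg] at hb ha hb' hv
    set a' := mvfderiv (𝓡 (2 * n - 1)) ((↑) : OddSphere n → CSpace n) x a
    set b' := mvfderiv (𝓡 (2 * n - 1)) ((↑) : OddSphere n → CSpace n) x b
    rw [← map_smul] at hb
    obtain ⟨h1, h2⟩ := Prod.ext_iff.1 (e.injective hb)
    simp only [Prod.smul_mk] at h1 h2
    refine ⟨a', ?_, ?_, ?_⟩
    · intro h
      simp [h] at hv
    -- Tangency of `a'` and of `I • a'` kills the real and the imaginary part of `⟪x, a'⟫`.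
    · rw [h1, inner_smul_right] at hb'
      apply Complex.ext
      · simpa using ha
      · simpa using hb'
    · rw [← h1, h2]
  · rintro ⟨v, hv, hxv, h⟩
    obtain ⟨a, ha⟩ := (mem_range_mvfderiv_coe_sphere x v).2 (by simp [hxv])
    obtain ⟨b, hb⟩ := (mem_range_mvfderiv_coe_sphere x (Complex.I • v)).2
      (by simp [hxv])
    simp only [ContinuousLinearMap.coe_coe] at ha hb
    refine ⟨e (v, fderiv ℝ g x v), ?_, ⟨a, ?_⟩, ⟨b, ?_⟩⟩
    · rw [Ne, e.map_eq_zero_iff]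
      exact fun h => hv (Prod.ext_iff.1 h).1
    · simp only [ContinuousLinearMap.coe_coe, mvfderiv_graph_apply e hg, ha]
    · simp only [ContinuousLinearMap.coe_coe, mvfderiv_graph_apply e hg, hb, ← map_smul,
        Prod.smul_mk, h]

end Graph

/-! ### Cayley coordinates on the sphere without the pole -/

open MvPolynomial

variable {n : ℕ} {κ : Type*} [Fintype κ] (b : OrthonormalBasis (Option κ) ℂ (CSpace n))

/-- The affine function `1 - ⟪p, z⟫`, which on the unit sphere vanishes only at the pole `p`, the
distinguished vector of the orthonormal basis `b`. -/
noncomputable def poleDefect (z : CSpace n) : ℂ := 1 - inner ℂ (b none) z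

/-- The holomorphic coordinates `1 / (1 - ⟪p, z⟫)` and `⟪b j, z⟫ / (1 - ⟪p, z⟫)` on the complement
of the pole. -/
noncomputable def cayley : Option κ → CSpace n → ℂ
  | none, z => (poleDefect b z)⁻¹
  | some j, z => inner ℂ (b (some j)) z * (poleDefect b z)⁻¹

/-- The holomorphic coordinates `cayley`, together with the conjugates of all but the first. -/
noncomputable def cayleyConj : Option κ ⊕ κ → CSpace n → ℂ :=
  Sum.elim (cayley b) fun j z => conj (cayley b (some j) z)

lemma cayley_none (z : CSpace n) : cayley b none z = (poleDefect b z)⁻¹ := rfl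

lemma cayley_some (j : κ) (z : CSpace n) :
    cayley b (some j) z = inner ℂ (b (some j)) z * (poleDefect b z)⁻¹ := rfl

lemma cayleyConj_inl (i : Option κ) (z : CSpace n) :
    cayleyConj b (Sum.inl i) z = cayley b i z := rfl

lemma cayleyConj_inr (j : κ) (z : CSpace n) :
    cayleyConj b (Sum.inr j) z = conj (cayley b (some j) z) := rfl

lemma sum_conj_inner_mul_inner (z v : CSpace n) :
    conj (inner ℂ (b none) z) * inner ℂ (b none) v
      + ∑ j, conj (inner ℂ (b (some j)) z) * inner ℂ (b (some j)) v = inner ℂ z v := by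
  rw [← b.sum_inner_mul_inner z v, Fintype.sum_option]
  simp

/-- This is `|z|² = 1` divided by `|1 - ⟪p, z⟫|²`. It eliminates `conj u`, leaving the `conj ζ_j` as
the only antiholomorphic variables. -/
lemma conj_cayley_none {z : CSpace n} (hz : ‖z‖ = 1) (hw : poleDefect b z ≠ 0) :
    conj (cayley b none z)
      = ∑ j, conj (cayley b (some j) z) * cayley b (some j) z + 1 - cayley b none z := by
  have h := sum_conj_inner_mul_inner b z z
  rw [inner_self_eq_norm_sq_to_K, hz] at h
  have hc : conj (poleDefect b z) ≠ 0 := by simpa using hw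
  have hs : ∑ j, conj (cayley b (some j) z) * cayley b (some j) z
      = (∑ j, conj (inner ℂ (b (some j)) z) * inner ℂ (b (some j)) z)
        * ((poleDefect b z)⁻¹ * (conj (poleDefect b z))⁻¹) := by
    rw [Finset.sum_mul]
    refine Finset.sum_congr rfl fun j _ => ?_
    simp only [cayley_some, map_mul, map_inv₀]
    ring
  rw [hs, eq_sub_of_add_eq' h]
  have h1 : inner ℂ (b none) z = 1 - poleDefect b z := by simp [poleDefect]
  simp only [cayley_none, map_inv₀, h1, map_sub, map_one]
  field_simp
  ring

/-- On the sphere without the pole, `φ` is a polynomial in the coordinates `cayleyConj`, up to a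
power of the nowhere vanishing function `|1 - ⟪p, z⟫| ^ 2`. -/
def IsCayleyRational (φ : CSpace n → ℂ) : Prop :=
  ∃ (P : MvPolynomial (Option κ ⊕ κ) ℂ) (D : ℕ), ∀ z : CSpace n, ‖z‖ = 1 → poleDefect b z ≠ 0 →
    eval (fun s => cayleyConj b s z) P
      = φ z * (cayley b none z * conj (cayley b none z)) ^ D

/-- The polynomial representing `conj (cayley b none)` on the sphere. -/
noncomputable def conjPoly (κ : Type*) [Fintype κ] : MvPolynomial (Option κ ⊕ κ) ℂ :=
  ∑ j : κ, X (Sum.inr j) * X (Sum.inl (some j)) + 1 - X (Sum.inl none)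

lemma eval_conjPoly {z : CSpace n} (hz : ‖z‖ = 1) (hw : poleDefect b z ≠ 0) :
    eval (fun s => cayleyConj b s z) (conjPoly κ) = conj (cayley b none z) := by
  rw [conj_cayley_none b hz hw]
  simp [conjPoly, cayleyConj_inl, cayleyConj_inr]

namespace IsCayleyRational

variable {b} {φ ψ : CSpace n → ℂ}

lemma const (c : ℂ) : IsCayleyRational b fun _ => c :=
  ⟨C c, 0, by simp⟩

lemma add (hφ : IsCayleyRational b φ) (hψ : IsCayleyRational b ψ) :
    IsCayleyRational b fun z => φ z + ψ z := by
  obtain ⟨P, D, hP⟩ := hφ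
  obtain ⟨Q, D', hQ⟩ := hψ
  refine ⟨P * (X (Sum.inl none) * conjPoly κ) ^ D' + Q * (X (Sum.inl none) * conjPoly κ) ^ D,
    D + D', fun z hz hw => ?_⟩
  simp only [map_add, map_mul, map_pow, eval_X, hP z hz hw, hQ z hz hw, eval_conjPoly b hz hw,
    cayleyConj_inl]
  ring

lemma mul (hφ : IsCayleyRational b φ) (hψ : IsCayleyRational b ψ) :
    IsCayleyRational b fun z => φ z * ψ z := by
  obtain ⟨P, D, hP⟩ := hφ
  obtain ⟨Q, D', hQ⟩ := hψ
  refine ⟨P * Q, D + D', fun z hz hw => ?_⟩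
  simp only [map_mul, hP z hz hw, hQ z hz hw]
  ring

lemma sum {ι : Type*} {s : Finset ι} {f : ι → CSpace n → ℂ}
    (hf : ∀ i ∈ s, IsCayleyRational b (f i)) : IsCayleyRational b fun z => ∑ i ∈ s, f i z := by
  classical
  induction s using Finset.induction_on with
  | empty => simpa using const 0
  | insert i s hi ih =>
    simp only [Finset.sum_insert hi]
    exact (hf i (by simp)).add (ih fun j hj => hf j (by simp [hj]))

lemma inner_basis (i : Option κ) : IsCayleyRational b fun z => inner ℂ (b i) z := by
  cases i with
  | none =>
    refine ⟨(X (Sum.inl none) - 1) * conjPoly κ, 1, fun z hz hw => ?_⟩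
    have h1 : inner ℂ (b none) z = 1 - poleDefect b z := by simp [poleDefect]
    simp only [map_mul, map_sub, map_one, eval_X, eval_conjPoly b hz hw, h1]
    simp only [cayleyConj_inl, cayley_none]
    field_simp
  | some j =>
    refine ⟨X (Sum.inl (some j)) * conjPoly κ, 1, fun z hz hw => ?_⟩
    simp only [map_mul, eval_X, eval_conjPoly b hz hw]
    simp only [cayleyConj_inl, cayley_none, cayley_some]
    ring

lemma conj_inner_basis (i : Option κ) :
    IsCayleyRational b fun z => conj (inner ℂ (b i) z) := by
  cases i with
  | none =>
    refine ⟨(conjPoly κ - 1) * X (Sum.inl none), 1, fun z hz hw => ?_⟩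
    have hc : conj (poleDefect b z) ≠ 0 := by simpa using hw
    have h1 : inner ℂ (b none) z = 1 - poleDefect b z := by simp [poleDefect]
    simp only [map_mul, map_sub, map_one, eval_X, eval_conjPoly b hz hw, h1]
    simp only [cayleyConj_inl, cayley_none, map_inv₀]
    field_simp
  | some j =>
    refine ⟨X (Sum.inr j) * X (Sum.inl none), 1, fun z hz hw => ?_⟩
    simp only [map_mul, eval_X]
    simp only [cayleyConj_inr, cayleyConj_inl, cayley_none, cayley_some, map_mul, map_inv₀]
    ring

lemma coord (j : Fin n) : IsCayleyRational b fun z => z j := by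
  have h (z : CSpace n) : z j = ∑ i, inner ℂ (b i) z * b i j := by
    conv_lhs => rw [← b.sum_repr' z]
    simp
  rw [funext h]
  exact sum fun i _ => (inner_basis i).mul (const _)

lemma conj_coord (j : Fin n) : IsCayleyRational b fun z => conj (z j) := by
  have h (z : CSpace n) : conj (z j) = ∑ i, conj (inner ℂ (b i) z) * conj (b i j) := by
    conv_lhs => rw [← b.sum_repr' z]
    simp
  rw [funext h]
  exact sum fun i _ => (conj_inner_basis i).mul (const _)

lemma realEval (q : MvPolynomial (Fin n ⊕ Fin n) ℝ) :
    IsCayleyRational b fun z => (ComplexTangency.realEval q z : ℂ) := by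
  unfold ComplexTangency.realEval
  induction q using MvPolynomial.induction_on with
  | C a => simpa using const (a : ℂ)
  | add p q hp hq => simpa using hp.add hq
  | mul_X p s hp =>
    simp only [map_mul, eval_X, Complex.ofReal_mul]
    refine hp.mul ?_
    rcases s with j | j
    · have h (z : CSpace n) : ((z j).re : ℂ) = (z j + conj (z j)) * 2⁻¹ := by
        rw [Complex.re_eq_add_conj, div_eq_mul_inv]
      simp only [Sum.elim_inl, h]
      exact ((coord j).add (conj_coord j)).mul (const _)
    · have h (z : CSpace n) :
          ((z j).im : ℂ) = (z j + conj (z j) * (-1)) * (2 * Complex.I)⁻¹ := by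
        rw [Complex.im_eq_sub_conj, div_eq_mul_inv]
        ring
      simp only [Sum.elim_inr, h]
      exact ((coord j).add ((conj_coord j).mul (const _))).mul (const _)

end IsCayleyRational

/-! ### Smoothness at the pole -/

lemma contDiff_poleDefect {k : ℕ∞ω} : ContDiff ℝ k (poleDefect b) :=
  contDiff_const.sub (((innerSL ℂ (b none)).restrictScalars ℝ).contDiff)

/-- Each factor `u` or `ζ_j` uses up one power of `w`, and each `conj ζ_j` adds one power of `1 /
conj w`; hence the induction runs over all `B` at once. -/
lemma exists_contDiff_pow_mul_eval (k : ℕ) (P : MvPolynomial (Option κ ⊕ κ) ℂ) :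
    ∀ B : ℕ, ∃ N₀, ∀ N ≥ N₀, ContDiff ℝ k fun z : CSpace n =>
      poleDefect b z ^ N * (conj (poleDefect b z))⁻¹ ^ B
        * eval (fun s => cayleyConj b s z) P := by
  induction P using MvPolynomial.induction_on with
  | C a =>
    intro B
    refine ⟨B + k + 2, fun N hN => ?_⟩
    simp only [eval_C]
    exact ((contDiff_pow_mul_conj_inv_pow k hN).comp (contDiff_poleDefect b)).mul contDiff_const
  | add p q hp hq =>
    intro B
    obtain ⟨N₁, h1⟩ := hp B
    obtain ⟨N₂, h2⟩ := hq B
    refine ⟨max N₁ N₂, fun N hN => ?_⟩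
    simp only [map_add, mul_add]
    exact (h1 N (le_of_max_le_left hN)).add (h2 N (le_of_max_le_right hN))
  | mul_X p s hp =>
    intro B
    have hlin (j : κ) : ContDiff ℝ k fun z : CSpace n => inner ℂ (b (some j)) z :=
      ((innerSL ℂ (b (some j))).restrictScalars ℝ).contDiff
    rcases s with (_ | j) | j
    · obtain ⟨N₀, h⟩ := hp B
      -- With `2` rather than `1`, a positive power of `w` remains after the cancellation, so both
      -- sides vanish at `w = 0`.
      refine ⟨N₀ + 2, fun N hN => ?_⟩
      obtain ⟨N, rfl⟩ := Nat.exists_eq_add_of_le' (le_of_add_le_right hN : 2 ≤ N)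
      convert! h (N + 1) (by omega) using 1
      ext z
      by_cases hw : poleDefect b z = 0
      · simp [hw]
      · simp only [map_mul, eval_X, cayleyConj_inl, cayley_none]
        field_simp
        ring
    · obtain ⟨N₀, h⟩ := hp B
      refine ⟨N₀ + 2, fun N hN => ?_⟩
      obtain ⟨N, rfl⟩ := Nat.exists_eq_add_of_le' (le_of_add_le_right hN : 2 ≤ N)
      convert! (h (N + 1) (by omega)).mul (hlin j) using 1
      ext z
      by_cases hw : poleDefect b z = 0
      · simp [hw]
      · simp only [map_mul, eval_X, cayleyConj_inl, cayley_some]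
        field_simp
        ring
    · obtain ⟨N₀, h⟩ := hp (B + 1)
      refine ⟨N₀, fun N hN => ?_⟩
      convert! (h N hN).mul (Complex.conjCLE.contDiff.comp (hlin j)) using 1
      ext z
      simp only [map_mul, eval_X, cayleyConj_inr, cayley_some, map_inv₀, Function.comp,
        Complex.conjCLE_apply]
      ring

/-! ### The tangential Cauchy-Riemann operator in Cayley coordinates -/

lemma hasFDerivAt_poleDefect (z : CSpace n) :
    HasFDerivAt (𝕜 := ℂ) (poleDefect b) (-innerSL ℂ (b none)) z := by
  simpa using! ((innerSL ℂ (b none)).hasFDerivAt (x := z)).const_sub 1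

lemma differentiableAt_cayley {z : CSpace n} (hw : poleDefect b z ≠ 0) (i : Option κ) :
    DifferentiableAt ℂ (cayley b i) z := by
  have h := (hasFDerivAt_poleDefect b z).differentiableAt.inv hw
  cases i with
  | none => exact h
  | some j => exact ((innerSL ℂ (b (some j))).differentiableAt).mul h

lemma fderiv_cayley_some {z : CSpace n} (hw : poleDefect b z ≠ 0) (j : κ) (v : CSpace n) :
    fderiv ℂ (cayley b (some j)) z v = inner ℂ (b (some j)) v * (poleDefect b z)⁻¹
      + inner ℂ (b (some j)) z * inner ℂ (b none) v * (poleDefect b z)⁻¹ ^ 2 := by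
  have h1 := (hasDerivAt_inv hw).comp_hasFDerivAt z (hasFDerivAt_poleDefect b z)
  have h2 := ((innerSL ℂ (b (some j))).hasFDerivAt (x := z)).mul h1
  have h3 : HasFDerivAt (𝕜 := ℂ) (cayley b (some j)) _ z := h2
  rw [h3.fderiv]
  simp
  ring

/-- The coordinates `cayley b (some j)` form a system of CR coordinates on the sphere without the
pole. -/
lemma eq_zero_of_fderiv_cayley_eq_zero {z v : CSpace n} (hz : ‖z‖ = 1) (hw : poleDefect b z ≠ 0)
    (hzv : inner ℂ z v = 0) (h : ∀ j, fderiv ℂ (cayley b (some j)) z v = 0) : v = 0 := by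
  have hj (j : κ) : inner ℂ (b (some j)) v
      = -(inner ℂ (b (some j)) z * inner ℂ (b none) v * (poleDefect b z)⁻¹) := by
    have := h j
    rw [fderiv_cayley_some b hw] at this
    field_simp at this ⊢
    linear_combination this
  have hc : conj (poleDefect b z) ≠ 0 := by simpa using hw
  have h1 : inner ℂ (b none) z = 1 - poleDefect b z := by simp [poleDefect]
  -- Inserting `hj` into `⟪z, v⟫ = 0` and using `|z| = 1` leaves `⟪p, v⟫ * conj w = 0`.
  have h0 : inner ℂ (b none) v = 0 := by
    have hs := sum_conj_inner_mul_inner b z z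
    have hs' := sum_conj_inner_mul_inner b z v
    rw [inner_self_eq_norm_sq_to_K, hz] at hs
    have : ∑ j, conj (inner ℂ (b (some j)) z) * inner ℂ (b (some j)) v
        = -((∑ j, conj (inner ℂ (b (some j)) z) * inner ℂ (b (some j)) z)
          * (inner ℂ (b none) v * (poleDefect b z)⁻¹)) := by
      rw [Finset.sum_mul, ← Finset.sum_neg_distrib]
      refine Finset.sum_congr rfl fun j _ => ?_
      rw [hj]
      ring
    rw [this, eq_sub_of_add_eq' hs, hzv, h1] at hs'
    simp only [map_sub, map_one] at hs'
    field_simp at hs'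
    have : inner ℂ (b none) v * conj (poleDefect b z) = 0 := by linear_combination -hs'
    exact (mul_eq_zero.1 this).resolve_right hc
  have hall (i : Option κ) : inner ℂ (b i) v = 0 := by
    cases i with
    | none => exact h0
    | some j => rw [hj, h0]; simp
  rw [← b.sum_repr' v]
  simp [hall]

/-- The antilinear part of the differential of a polynomial in `cayleyConj`. -/
lemma fderiv_pow_mul_eval_smul_I {z : CSpace n} (hw : poleDefect b z ≠ 0) (N : ℕ)
    (P : MvPolynomial (Option κ ⊕ κ) ℂ) (v : CSpace n) :
    fderiv ℝ (fun z => poleDefect b z ^ N * eval (fun s => cayleyConj b s z) P) z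
        (Complex.I • v)
      - Complex.I * fderiv ℝ (fun z => poleDefect b z ^ N
          * eval (fun s => cayleyConj b s z) P) z v
      = -2 * Complex.I * poleDefect b z ^ N
        * ∑ j, eval (fun s => cayleyConj b s z) (pderiv (Sum.inr j) P)
          * conj (fderiv ℂ (cayley b (some j)) z v) := by
  have h1 := ((hasFDerivAt_poleDefect b z).differentiableAt.pow N).hasFDerivAt.restrictScalars ℝ
  have h2 (i : Option κ) := (differentiableAt_cayley b hw i).hasFDerivAt.restrictScalars ℝ
  have h3 (s : Option κ ⊕ κ) : HasFDerivAt (cayleyConj b s)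
      (Sum.elim (fun i => (fderiv ℂ (cayley b i) z).restrictScalars ℝ)
        (fun j => (Complex.conjCLE : ℂ →L[ℝ] ℂ).comp
          ((fderiv ℂ (cayley b (some j)) z).restrictScalars ℝ)) s) z := by
    rcases s with i | j
    · exact h2 i
    · exact Complex.conjCLE.hasFDerivAt.comp z (h2 (some j))
  have h4 := h1.mul (hasFDerivAt_mvPolynomial_eval h3 P)
  have h5 : HasFDerivAt (fun z => poleDefect b z ^ N * eval (fun s => cayleyConj b s z) P) _ z := h4
  rw [h5.fderiv]
  have hlin (i : Option κ) : fderiv ℂ (cayley b i) z (Complex.I • v)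
      = Complex.I * fderiv ℂ (cayley b i) z v := by rw [map_smul, smul_eq_mul]
  have hI (f h : κ → ℂ) : ∑ j, f j * (Complex.I * h j) = Complex.I * ∑ j, f j * h j := by
    rw [Finset.mul_sum]
    exact Finset.sum_congr rfl fun j _ => by ring
  simp [hlin, hI]
  ring

/-! ### Construction of the embedding -/

lemma exists_orthonormalBasis_none {n : ℕ} [NeZero n] {p : CSpace n} (hp : ‖p‖ = 1) :
    ∃ b : OrthonormalBasis (Option (Fin (n - 1))) ℂ (CSpace n), b none = p := by
  have hcard : Module.finrank ℂ (CSpace n) = Fintype.card (Option (Fin (n - 1))) := by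
    have := NeZero.ne n
    simp
    omega
  obtain ⟨b, hb⟩ := Orthonormal.exists_orthonormalBasis_extension_of_card_eq hcard
    (v := fun _ => p) (s := {none}) (by
      constructor
      · rintro ⟨i, hi⟩
        simpa using hp
      · rintro ⟨i, hi⟩ ⟨j, hj⟩ hij
        exact absurd (Subtype.ext ((Set.mem_singleton_iff.1 hi).trans
          (Set.mem_singleton_iff.1 hj).symm)) hij)
  exact ⟨b, hb none rfl⟩

lemma poleDefect_eq_zero_iff {z : CSpace n} (hz : ‖z‖ = 1) :
    poleDefect b z = 0 ↔ z = b none := by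
  rw [poleDefect, sub_eq_zero, eq_comm,
    inner_eq_one_iff_of_norm_eq_one (b.orthonormal.1 none) hz, eq_comm]

/-- The map of `ℂ^n` given by polynomials in `cayleyConj`, made differentiable at the pole by a
power of the CR function `1 - ⟪p, z⟫`. -/
noncomputable def cayleyMap {ι : Type*} (N : ℕ) (G : ι → MvPolynomial (Option κ ⊕ κ) ℂ)
    (z : CSpace n) : ι → ℂ :=
  fun j => poleDefect b z ^ N * eval (fun s => cayleyConj b s z) (G j)

lemma exists_contDiff_cayleyMap {ι : Type*} [Fintype ι] (k : ℕ)
    (G : ι → MvPolynomial (Option κ ⊕ κ) ℂ) :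
    ∃ N₀, ∀ N ≥ N₀, ContDiff ℝ k (cayleyMap b N G) := by
  choose N₀ h using fun j => exists_contDiff_pow_mul_eval b k (G j) 0
  refine ⟨Finset.univ.sup N₀, fun N hN => contDiff_pi.2 fun j => ?_⟩
  simpa [cayleyMap] using h j N ((Finset.le_sup (Finset.mem_univ j)).trans hN)

/-- At the points other than the pole, the tangential Cauchy-Riemann operator of `cayleyMap` is
degenerate where `P` vanishes, if `G` consists of the antiholomorphic coordinates with one of them
replaced by a primitive of `P`. -/
lemma exists_fderiv_cayleyMap_smul_I_iff [DecidableEq κ] {N : ℕ}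
    {G : κ → MvPolynomial (Option κ ⊕ κ) ℂ} {P : MvPolynomial (Option κ ⊕ κ) ℂ} {i₀ : κ}
    (hG : ∀ i ≠ i₀, G i = X (Sum.inr i)) (hP : pderiv (Sum.inr i₀) (G i₀) = P)
    (hd : Differentiable ℝ (cayleyMap b N G)) {z : CSpace n} (hz : ‖z‖ = 1)
    (hw : poleDefect b z ≠ 0) :
    (∃ v : CSpace n, v ≠ 0 ∧ inner ℂ z v = 0 ∧ fderiv ℝ (cayleyMap b N G) z (Complex.I • v)
        = Complex.I • fderiv ℝ (cayleyMap b N G) z v) ↔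
      eval (fun s => cayleyConj b s z) P = 0 := by
  have hcr (v : CSpace n) : fderiv ℝ (cayleyMap b N G) z (Complex.I • v)
        = Complex.I • fderiv ℝ (cayleyMap b N G) z v ↔
      ∀ i, ∑ j, eval (fun s => cayleyConj b s z) (pderiv (Sum.inr j) (G i))
          * conj (fderiv ℂ (cayley b (some j)) z v) = 0 := by
    rw [funext_iff]
    refine forall_congr' fun i => ?_
    have hi (u : CSpace n) : fderiv ℝ (cayleyMap b N G) z u i
        = fderiv ℝ (fun z => poleDefect b z ^ N * eval (fun s => cayleyConj b s z) (G i)) z u := by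
      have := (hasFDerivAt_pi'.1 (hd z).hasFDerivAt i).fderiv
      exact (congrArg (fun L : CSpace n →L[ℝ] ℂ => L u) this).symm
    rw [Pi.smul_apply, hi, hi, smul_eq_mul, ← sub_eq_zero, fderiv_pow_mul_eval_smul_I b hw]
    simp [hw]
  have hne (i : κ) (hi : i ≠ i₀) (v : CSpace n) :
      ∑ j, eval (fun s => cayleyConj b s z) (pderiv (Sum.inr j) (G i))
          * conj (fderiv ℂ (cayley b (some j)) z v)
        = conj (fderiv ℂ (cayley b (some i)) z v) := by
    rw [Finset.sum_eq_single i]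
    · simp [hG i hi]
    · intro j _ hj
      rw [hG i hi, pderiv_X_of_ne (by simpa using hj.symm)]
      simp
    · simp
  have heq (v : CSpace n) (hv : ∀ i ≠ i₀, fderiv ℂ (cayley b (some i)) z v = 0) :
      ∑ j, eval (fun s => cayleyConj b s z) (pderiv (Sum.inr j) (G i₀))
          * conj (fderiv ℂ (cayley b (some j)) z v)
        = eval (fun s => cayleyConj b s z) P * conj (fderiv ℂ (cayley b (some i₀)) z v) := by
    rw [Finset.sum_eq_single i₀, hP]
    · intro j _ hj
      simp [hv j hj]
    · simp
  simp only [hcr]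
  constructor
  · rintro ⟨v, hv, hzv, h⟩
    by_contra hP0
    have h1 : ∀ i ≠ i₀, fderiv ℂ (cayley b (some i)) z v = 0 := fun i hi => by
      simpa [hne i hi] using h i
    have h2 : fderiv ℂ (cayley b (some i₀)) z v = 0 := by
      simpa [heq v h1, hP0] using h i₀
    refine hv (eq_zero_of_fderiv_cayley_eq_zero b hz hw hzv fun i => ?_)
    rcases eq_or_ne i i₀ with rfl | hi
    exacts [h2, h1 i hi]
  · intro hP0
    -- When `P = 0` the row `i₀` imposes nothing beyond the other rows, so its slot is free for the
    -- condition `⟪z, v⟫ = 0`. One equation fewer than the dimension remains, giving `v ≠ 0`.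
    let L : CSpace n →ₗ[ℂ] (κ → ℂ) := LinearMap.pi fun i =>
      if i = i₀ then (innerSL ℂ z : CSpace n →ₗ[ℂ] ℂ)
      else (fderiv ℂ (cayley b (some i)) z : CSpace n →ₗ[ℂ] ℂ)
    have hfin : Module.finrank ℂ (κ → ℂ) < Module.finrank ℂ (CSpace n) := by
      rw [Module.finrank_eq_card_basis b.toBasis]
      simp
    obtain ⟨v, hvL, hv⟩ := (Submodule.ne_bot_iff _).1
      (LinearMap.ker_ne_bot_of_finrank_lt (f := L) hfin)
    have hL (i : κ) : L v i = 0 := congrFun (LinearMap.mem_ker.1 hvL) i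
    have h1 : ∀ i ≠ i₀, fderiv ℂ (cayley b (some i)) z v = 0 := fun i hi => by
      simpa [L, hi] using hL i
    refine ⟨v, hv, by simpa [L] using hL i₀, fun i => ?_⟩
    rcases eq_or_ne i i₀ with rfl | hi
    · rw [heq v h1, hP0, zero_mul]
    · rw [hne i hi, h1 i hi, map_zero]

/-- At the pole the differential of `cayleyMap` vanishes. -/
lemma fderiv_cayleyMap_pole {ι : Type*} [Fintype ι] {N : ℕ}
    {G : ι → MvPolynomial (Option κ ⊕ κ) ℂ} (hN : N ≠ 0)
    (hd : Differentiable ℝ (cayleyMap b N G)) :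
    fderiv ℝ (cayleyMap b (N + 1) G) (b none) = 0 := by
  have h0 : poleDefect b (b none) = 0 :=
    (poleDefect_eq_zero_iff b (b.orthonormal.1 none)).2 rfl
  have h1 : cayleyMap b N G (b none) = 0 := by
    ext j
    simp [cayleyMap, h0, hN]
  have h2 : cayleyMap b (N + 1) G = fun z => poleDefect b z • cayleyMap b N G z := by
    ext z j
    simp only [cayleyMap, Pi.smul_apply, smul_eq_mul]
    ring
  rw [h2]
  refine (((hasFDerivAt_poleDefect b (b none)).restrictScalars ℝ).smul
    (hd (b none)).hasFDerivAt).fderiv.trans ?_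
  ext v
  simp [h0, h1]

/-- Every nonempty subset of the sphere cut out by two real polynomial equations is the set of
complex tangents of a `C^k` embedding. -/
lemma exists_isCkEmbedding_complexTangents_eq {n : ℕ} [NeZero n] (hn : 2 ≤ n) (k : ℕ)
    (A : Set (OddSphere n)) (hA : A.Nonempty) {q₁ q₂ : MvPolynomial (Fin n ⊕ Fin n) ℝ}
    (hmem : ∀ x : OddSphere n,
      x ∈ A ↔ realEval q₁ (x : CSpace n) = 0 ∧ realEval q₂ (x : CSpace n) = 0) :
    ∃ f : OddSphere n → CSpace (2 * n - 1),
      IsCkEmbedding (𝓡 (2 * n - 1)) k f ∧ complexTangents (𝓡 (2 * n - 1)) f = A := by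
  obtain ⟨p, hp⟩ := hA
  have hnorm (x : OddSphere n) : ‖(x : CSpace n)‖ = 1 := norm_eq_of_mem_sphere x
  obtain ⟨b, hb⟩ := exists_orthonormalBasis_none (hnorm p)
  let i₀ : Fin (n - 1) := ⟨0, by omega⟩
  -- The two real equations become the single complex equation `q₁ + i q₂ = 0`.
  obtain ⟨P, D, hPD⟩ := (IsCayleyRational.realEval (b := b) q₁).add
    ((IsCayleyRational.realEval q₂).mul (.const Complex.I))
  obtain ⟨G₀, hG₀⟩ := surjective_pderiv (Sum.inr i₀) P
  let G : Fin (n - 1) → MvPolynomial (Option (Fin (n - 1)) ⊕ Fin (n - 1)) ℂ :=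
    fun i => if i = i₀ then G₀ else MvPolynomial.X (Sum.inr i)
  -- Using `k + 1` guarantees a differential even for `k = 0`.
  obtain ⟨N₀, hN₀⟩ := exists_contDiff_cayleyMap b (k + 1) G
  -- At the pole one factor `w` is split off; the remaining exponent `N₀ + 1` must be nonzero and at
  -- least `N₀`.
  have hg := hN₀ (N₀ + 2) (by omega)
  have hd : Differentiable ℝ (cayleyMap b (N₀ + 2) G) := hg.differentiable (by norm_cast)
  have he : Module.finrank ℂ (CSpace n × (Fin (n - 1) → ℂ))
      = Module.finrank ℂ (CSpace (2 * n - 1)) := by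
    simp
    omega
  let e : (CSpace n × (Fin (n - 1) → ℂ)) ≃L[ℂ] CSpace (2 * n - 1) :=
    ContinuousLinearEquiv.ofFinrankEq he
  have hemb := isCkEmbedding_graph e (by omega) hg
  refine ⟨fun x => e (x, cayleyMap b (N₀ + 2) G x), ⟨?_, hemb.2, hemb.3⟩, ?_⟩
  · exact hemb.1.of_le (by exact_mod_cast Nat.le_succ k)
  ext x
  rw [mem_complexTangents_graph e hd]
  by_cases hw : poleDefect b x = 0
  · have hx : (x : CSpace n) = b none := (poleDefect_eq_zero_iff b (hnorm x)).1 hw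
    have hxp : x = p := Subtype.ext (hx.trans hb)
    refine iff_of_true ⟨b (some i₀), b.orthonormal.ne_zero _, ?_, ?_⟩ (hxp ▸ hp)
    · rw [hx]
      exact b.orthonormal.2 (by simp)
    · rw [hx, fderiv_cayleyMap_pole b (by omega)
        ((hN₀ (N₀ + 1) (by omega)).differentiable (by norm_cast))]
      simp
  · rw [exists_fderiv_cayleyMap_smul_I_iff b (P := P) (i₀ := i₀) (fun i hi => if_neg hi)
      (by simpa [G] using hG₀) hd (hnorm x) hw, hPD x (hnorm x) hw]
    have hu : cayley b none (x : CSpace n) ≠ 0 := inv_ne_zero hw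
    have hu' : conj (cayley b none (x : CSpace n)) ≠ 0 := by simpa using hu
    rw [mul_eq_zero, or_iff_left (pow_ne_zero _ (mul_ne_zero hu hu')), Complex.ext_iff,
      hmem]
    simp

end ComplexTangency

theorem theorem3 (n : ℕ) [NeZero n] (hn : 2 ≤ n) (k : ℕ) (A : Set (OddSphere n))
    (hA : A.Nonempty) (hAlg : IsAlgebraicByTwo A) :
    ∃ f : OddSphere n → CSpace (2 * n - 1),
      IsCkEmbedding (𝓡 (2 * n - 1)) k f ∧ complexTangents (𝓡 (2 * n - 1)) f = A := by
  obtain ⟨q₁, q₂, hq⟩ := hAlg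
  refine exists_isCkEmbedding_complexTangents_eq hn k A hA (q₁ := q₁) (q₂ := q₂) fun x => ?_
  rw [← Subtype.val_injective.mem_set_image (s := A), hq, Set.mem_ofPred_eq]
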